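/- Let $X$ be a compact metric space and $T\colon X\to X$ a continuous map. Write $C(X)$ for the set of continuous functions $f\colon X\to\mathbb{R}$, and for $f\in C(X)$ and $x\in X$ put $$f^{*}(x)=\lim_{n\to+\infty}\frac1n\sum_{k=1}^{n}f(T^{k}x),\qquad f_B^{*}(x)=\lim_{n-m\to+\infty}\frac1{n-m}\sum_{k=m}^{n-1}f(T^{k}x)\quad(m,n\in\mathbb{N},\ m<n),$$ whenever the limit exists; the second limit is uniform in the position $m$ of the interval $[m,n)$. We say that $f^{*}$ (respectively $f_B^{*}$) is continuous if the limit exists at every $x\in X$ and is a continuous function of $x$. Consider the equivalence (E) $f_B^{*}$ is continuous for all $f\in C(X)$ if and only if $f^{*}$ is continuous for all $f\in C(X)$. 1. If $(X,T)$ is transitive, i.e. there is a point $x\in X$ whose orbit $\{x,Tx,T^{2}x,\dots\}$ is dense in $X$, then (E) holds. 2. If $(X,T)$ is uniquely ergodic, i.e. there is exactly one ergodic $T$-invariant Borel probability measure on $X$, then (E) holds. 3. If $(X,T)$ is minimal, i.e. the orbit $\{x,Tx,T^{2}x,\dots\}$ of every point $x\in X$ is dense in $X$, then (E) holds. -/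

import Mathlib

open Filter Topology MeasureTheory

namespace TimeAverage

/-- The filter on pairs `(m, n)` of natural numbers describing the limit `n - m → +∞`
(the subtraction is that of the integers, and `m` is otherwise unrestricted). -/
noncomputable def lengthAtTop : Filter (ℕ × ℕ) :=
  comap (fun p : ℕ × ℕ => (p.2 : ℤ) - (p.1 : ℤ)) atTop

/-- `g` is the time average `f^*` of `f`: at every point `x` the limit
`lim_{n → ∞} (1 / n) ∑_{k = 1}^{n} f (T^k x)` exists and equals `g x`. -/
def IsTimeAverage {X : Type*} (T : X → X) (f g : X → ℝ) : Prop :=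
  ∀ x : X, Tendsto (fun n : ℕ => (1 / (n : ℝ)) * ∑ k ∈ Finset.Icc 1 n, f (T^[k] x))
    atTop (𝓝 (g x))

/-- `g` is the uniform time average `f_B^*` of `f`: at every point `x` the limit
`lim_{n - m → ∞} (1 / (n - m)) ∑_{k = m}^{n - 1} f (T^k x)` exists and equals `g x`. -/
def IsUniformTimeAverage {X : Type*} (T : X → X) (f g : X → ℝ) : Prop :=
  ∀ x : X, Tendsto (fun p : ℕ × ℕ =>
      (1 / ((p.2 : ℝ) - (p.1 : ℝ))) * ∑ k ∈ Finset.Ico p.1 p.2, f (T^[k] x))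
    lengthAtTop (𝓝 (g x))

/-- For every `f ∈ C(X)` the time average `f^*` exists at every point and is continuous. -/
def TimeAveragesContinuous {X : Type*} [TopologicalSpace X] (T : X → X) : Prop :=
  ∀ f : X → ℝ, Continuous f → ∃ g : X → ℝ, IsTimeAverage T f g ∧ Continuous g

/-- For every `f ∈ C(X)` the uniform time average `f_B^*` exists at every point and is
continuous. -/
def UniformTimeAveragesContinuous {X : Type*} [TopologicalSpace X] (T : X → X) : Prop :=
  ∀ f : X → ℝ, Continuous f → ∃ g : X → ℝ, IsUniformTimeAverage T f g ∧ Continuous g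

/-- The forward orbit `{x, T x, T² x, …}`. -/
def orbit {X : Type*} (T : X → X) (x : X) : Set X :=
  Set.range fun n : ℕ => T^[n] x

/-- `(X, T)` is transitive: some point has a dense orbit. -/
def IsTransitive {X : Type*} [TopologicalSpace X] (T : X → X) : Prop :=
  ∃ x : X, Dense (orbit T x)

/-- `(X, T)` is minimal: every point has a dense orbit. -/
def IsMinimal {X : Type*} [TopologicalSpace X] (T : X → X) : Prop :=
  ∀ x : X, Dense (orbit T x)

/-- `(X, T)` is uniquely ergodic: there is exactly one ergodic invariant (Borel) probability
measure. -/
def IsUniquelyErgodic {X : Type*} [MeasurableSpace X] (T : X → X) : Prop :=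
  ∃! μ : Measure X, IsProbabilityMeasure μ ∧ Ergodic T μ

end TimeAverage

/-! The substance is that a continuous limit `g` of the averages is attained uniformly along orbits.
Since `g` is `T`-invariant, `h = f - g` is continuous with Birkhoff averages tending pointwise to
`0`. By compactness each point has a good time, bounded by one `N`, at which the average of `h` is
small. Tiling orbits by good pieces makes long averages small at all points at once
(`eventually_abs_birkhoffSum_le`). At `T^[m] x`, where `g` still equals `g x`, this bounds the
window starting at `m`, uniformly in `m`. -/

namespace TimeAverage

/-- If every orbit segment can be started with a piece of length at most `N` along which the
Birkhoff sum is at most `ε` times the length, then by tiling all Birkhoff sums are controlled. -/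
theorem abs_birkhoffSum_le_of_tiling {X : Type*} {T : X → X} {h : X → ℝ} {ε M : ℝ} {N : ℕ}
    (hε : 0 ≤ ε) (hM : ∀ x, |h x| ≤ M)
    (htile : ∀ x, ∃ n, 0 < n ∧ n ≤ N ∧ |birkhoffSum T h n x| ≤ ε * n) (L : ℕ) (x : X) :
    |birkhoffSum T h L x| ≤ ε * L + N * M := by
  have hM0 : 0 ≤ M := (abs_nonneg _).trans (hM x)
  induction L using Nat.strong_induction_on generalizing x with
  | _ L ih =>
    -- A segment of length at most `N` is the untiled remainder; it alone costs `N * M`.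
    rcases le_total L N with hL | hL
    · have h1 : |birkhoffSum T h L x| ≤ L * M := by
        calc |birkhoffSum T h L x| ≤ ∑ k ∈ Finset.range L, |h (T^[k] x)| :=
              Finset.abs_sum_le_sum_abs _ _
          _ ≤ ∑ _k ∈ Finset.range L, M := Finset.sum_le_sum fun k _ => hM _
          _ = L * M := by simp
      have h2 : (L : ℝ) * M ≤ N * M := by gcongr
      have h3 : 0 ≤ ε * L := by positivity
      linarith
    · obtain ⟨n, hn0, hnN, hn⟩ := htile x
      obtain ⟨l, rfl⟩ := Nat.exists_eq_add_of_le (hnN.trans hL)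
      rw [birkhoffSum_add]
      have h1 := ih l (by omega) (T^[n] x)
      have h2 := abs_add_le (birkhoffSum T h n x) (birkhoffSum T h l (T^[n] x))
      push_cast
      linarith

/-- On a compact space, Birkhoff averages of a continuous function that tend to `0` pointwise
tend to `0` uniformly. -/
theorem eventually_abs_birkhoffSum_le {X : Type*} [TopologicalSpace X] [CompactSpace X]
    {T : X → X} (hT : Continuous T) {h : X → ℝ} (hh : Continuous h)
    (hlim : ∀ x, Tendsto (fun n => birkhoffAverage ℝ T h n x) atTop (𝓝 0))
    {ε : ℝ} (hε : 0 < ε) :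
    ∀ᶠ n : ℕ in atTop, ∀ x, |birkhoffSum T h n x| ≤ ε * n := by
  have hcont (n : ℕ) : Continuous (birkhoffSum T h n) :=
    continuous_finsetSum _ fun k _ => hh.comp (hT.iterate k)
  -- Lengths `n + 1` exclude the empty tile; the other `ε / 2` later absorbs the remainder `N * M`.
  obtain ⟨t, ht⟩ := isCompact_univ.elim_finite_subcover
    (fun n : ℕ => {x | |birkhoffSum T h (n + 1) x| < ε / 2 * ((n : ℝ) + 1)})
    (fun n => isOpen_lt (hcont _).abs continuous_const) (fun x _ => by
      have h1 := ((hlim x).comp (tendsto_add_atTop_nat 1)).eventually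
        (Metric.ball_mem_nhds 0 (half_pos hε))
      obtain ⟨n, hn⟩ := h1.exists
      refine Set.mem_iUnion.2 ⟨n, ?_⟩
      have hn0 : (0 : ℝ) < n + 1 := by positivity
      simp only [Function.comp_apply, birkhoffAverage, dist_zero_right,
        Real.norm_eq_abs, smul_eq_mul, abs_mul, Nat.cast_add, Nat.cast_one, abs_inv,
        abs_of_pos hn0] at hn
      rwa [inv_mul_lt_iff₀ hn0, mul_comm] at hn)
  have htile (x : X) : ∃ n, 0 < n ∧ n ≤ t.sup id + 1 ∧ |birkhoffSum T h n x| ≤ ε / 2 * n := by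
    obtain ⟨n, hn, hx⟩ := Set.mem_iUnion₂.1 (ht (Set.mem_univ x))
    have : n ≤ t.sup id := Finset.le_sup (f := id) hn
    exact ⟨n + 1, by omega, by omega, by push_cast; exact le_of_lt hx⟩
  obtain ⟨M, hM⟩ := isCompact_univ.exists_bound_of_continuousOn hh.continuousOn
  have key := abs_birkhoffSum_le_of_tiling (half_pos hε).le (fun x => hM x (Set.mem_univ x)) htile
  filter_upwards [tendsto_natCast_atTop_atTop.eventually_ge_atTop
    (((t.sup id + 1 : ℕ) : ℝ) * M / (ε / 2))] with n hn x
  rw [div_le_iff₀ (half_pos hε)] at hn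
  linarith [key n x]

/-- The sum in the definition of the time average at `x` is a Birkhoff sum at `T x`. -/
theorem sum_Icc_one_eq_birkhoffSum {X : Type*} (T : X → X) (f : X → ℝ) (n : ℕ) (x : X) :
    ∑ k ∈ Finset.Icc 1 n, f (T^[k] x) = birkhoffSum T f n (T x) := by
  rw [← Finset.Ico_add_one_right_eq_Icc, Finset.sum_Ico_eq_sum_range, birkhoffSum]
  refine Finset.sum_congr (by simp) fun k _ => ?_
  rw [add_comm, Function.iterate_succ_apply]

theorem IsTimeAverage.tendsto_birkhoffAverage_map {X : Type*} {T : X → X} {f g : X → ℝ}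
    (hg : IsTimeAverage T f g) (x : X) :
    Tendsto (fun n => birkhoffAverage ℝ T f n (T x)) atTop (𝓝 (g x)) := by
  simpa only [birkhoffAverage, smul_eq_mul, one_div, sum_Icc_one_eq_birkhoffSum] using hg x

/-- Moving the start from `T x` to `x` changes the sum by two boundary terms, negligible after
dividing by `n` because `f` is bounded. -/
theorem IsTimeAverage.tendsto_birkhoffAverage {X : Type*} [TopologicalSpace X] [CompactSpace X]
    {T : X → X} {f g : X → ℝ} (hf : Continuous f) (hg : IsTimeAverage T f g) (x : X) :
    Tendsto (fun n => birkhoffAverage ℝ T f n x) atTop (𝓝 (g x)) := by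
  have hb : Bornology.IsBounded (Set.range f) := (isCompact_range hf).isBounded
  have h1 := tendsto_birkhoffAverage_apply_sub_birkhoffAverage' ℝ hb T x
  simpa using (hg.tendsto_birkhoffAverage_map x).sub h1

theorem IsTimeAverage.comp_eq {X : Type*} [TopologicalSpace X] [CompactSpace X]
    {T : X → X} {f g : X → ℝ} (hf : Continuous f) (hg : IsTimeAverage T f g) (x : X) :
    g (T x) = g x :=
  tendsto_nhds_unique (hg.tendsto_birkhoffAverage hf (T x)) (hg.tendsto_birkhoffAverage_map x)

theorem IsTimeAverage.iterate_eq {X : Type*} [TopologicalSpace X] [CompactSpace X]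
    {T : X → X} {f g : X → ℝ} (hf : Continuous f) (hg : IsTimeAverage T f g) (k : ℕ) (x : X) :
    g (T^[k] x) = g x := by
  induction k with
  | zero => rfl
  | succ k ih => rw [Function.iterate_succ_apply', hg.comp_eq hf, ih]

theorem IsTimeAverage.birkhoffSum_sub {X : Type*} [TopologicalSpace X] [CompactSpace X]
    {T : X → X} {f g : X → ℝ} (hf : Continuous f) (hg : IsTimeAverage T f g) (n : ℕ) (x : X) :
    birkhoffSum T (f - g) n x = birkhoffSum T f n x - n * g x := by
  simp [birkhoffSum, Finset.sum_sub_distrib, hg.iterate_eq hf]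

/-- A continuous time average of a continuous function is a uniform time average. -/
theorem IsTimeAverage.isUniformTimeAverage {X : Type*} [TopologicalSpace X] [CompactSpace X]
    {T : X → X} (hT : Continuous T) {f g : X → ℝ} (hf : Continuous f)
    (hg : IsTimeAverage T f g) (hgc : Continuous g) : IsUniformTimeAverage T f g := by
  have hlim (x : X) :
      Tendsto (fun n => birkhoffAverage ℝ T (f - g) n x) atTop (𝓝 0) := by
    have h1 := (hg.tendsto_birkhoffAverage hf x).sub_const (g x)
    rw [sub_self] at h1
    refine h1.congr' ?_
    filter_upwards [eventually_gt_atTop 0] with n hn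
    have : (n : ℝ) ≠ 0 := by positivity
    simp only [birkhoffAverage, smul_eq_mul, hg.birkhoffSum_sub hf]
    field_simp
  intro x
  rw [Metric.tendsto_nhds]
  intro ε hε
  obtain ⟨N, hN⟩ := eventually_atTop.1
    (eventually_abs_birkhoffSum_le hT (hf.sub hgc) hlim (half_pos hε))
  -- The extra `1` keeps the window length positive even when `N = 0`.
  have hlen : ∀ᶠ p : ℕ × ℕ in lengthAtTop, (N : ℤ) + 1 ≤ (p.2 : ℤ) - p.1 :=
    tendsto_comap.eventually (eventually_ge_atTop ((N : ℤ) + 1))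
  filter_upwards [hlen] with p hp
  obtain ⟨m, n⟩ := p
  obtain ⟨l, rfl⟩ : ∃ l, n = m + l := Nat.exists_eq_add_of_le (by simp only at hp; omega)
  have hl : N + 1 ≤ l := by push_cast at hp; omega
  have hl0 : (0 : ℝ) < l := by exact_mod_cast (by omega : 0 < l)
  have hsum : ∑ k ∈ Finset.Ico m (m + l), f (T^[k] x) = birkhoffSum T f l (T^[m] x) := by
    rw [Finset.sum_Ico_eq_sum_range, add_tsub_cancel_left, birkhoffSum]
    refine Finset.sum_congr rfl fun k _ => ?_
    rw [add_comm, Function.iterate_add_apply]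
  have key := hN l (by omega) (T^[m] x)
  rw [hg.birkhoffSum_sub hf, hg.iterate_eq hf] at key
  have heq : 1 / (((m + l : ℕ) : ℝ) - m) * birkhoffSum T f l (T^[m] x) - g x =
      (birkhoffSum T f l (T^[m] x) - l * g x) / l := by
    push_cast
    rw [add_sub_cancel_left]
    field_simp
  simp only
  rw [hsum, Real.dist_eq, heq, abs_div, abs_of_pos hl0, div_lt_iff₀ hl0]
  nlinarith

/-- The windows `[1, n + 1)` are exactly the index ranges of the ordinary time average. -/
theorem tendsto_one_succ_lengthAtTop :
    Tendsto (fun n : ℕ => ((1, n + 1) : ℕ × ℕ)) atTop lengthAtTop := by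
  rw [lengthAtTop, tendsto_comap_iff]
  refine tendsto_natCast_atTop_atTop.congr fun n => ?_
  simp

/-- A uniform time average is a time average. -/
theorem IsUniformTimeAverage.isTimeAverage {X : Type*} {T : X → X} {f g : X → ℝ}
    (hg : IsUniformTimeAverage T f g) : IsTimeAverage T f g := by
  intro x
  refine ((hg x).comp tendsto_one_succ_lengthAtTop).congr fun n => ?_
  simp [Finset.Ico_add_one_right_eq_Icc]

/-- For a continuous self-map of a compact space, all uniform time averages of continuous
functions are continuous if and only if all time averages are. -/
theorem uniformTimeAveragesContinuous_iff {X : Type*} [TopologicalSpace X] [CompactSpace X]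
    {T : X → X} (hT : Continuous T) :
    UniformTimeAveragesContinuous T ↔ TimeAveragesContinuous T := by
  constructor <;> intro h f hf <;> obtain ⟨g, hg, hgc⟩ := h f hf
  · exact ⟨g, hg.isTimeAverage, hgc⟩
  · exact ⟨g, hg.isUniformTimeAverage hT hf hgc, hgc⟩

end TimeAverage

theorem corollary6p15 {X : Type*} [MetricSpace X] [CompactSpace X]
    [MeasurableSpace X] [BorelSpace X] (T : X → X) (hT : Continuous T) :
    (TimeAverage.IsTransitive T →
      (TimeAverage.UniformTimeAveragesContinuous T ↔ TimeAverage.TimeAveragesContinuous T)) ∧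
    (TimeAverage.IsUniquelyErgodic T →
      (TimeAverage.UniformTimeAveragesContinuous T ↔ TimeAverage.TimeAveragesContinuous T)) ∧
    (TimeAverage.IsMinimal T →
      (TimeAverage.UniformTimeAveragesContinuous T ↔ TimeAverage.TimeAveragesContinuous T)) :=
  have h := TimeAverage.uniformTimeAveragesContinuous_iff hT
  ⟨fun _ => h, fun _ => h, fun _ => h⟩
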